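/- Let $f:\mathbb{C}\to\mathbb{C}$ be a transcendental entire function in the Eremenko–Lyubich class $\mathcal{B}$, i.e. such that the closure $S(f)$ of the set of its critical values and finite asymptotic values is bounded. Let $J(f)$ denote its Julia set (the complement of the set of points having a neighbourhood on which the iterates $f^n$ form a normal family) and let $I(f)=\{z\in\mathbb{C}: f^n(z)\to\infty\}$ denote its escaping set. For $R\ge 0$ put \[J_R(f)=\{z\in J(f): |f^n(z)|\ge R \text{ for all } n\ge 1\}.\] A set $B\subset[0,+\infty)\times(\mathbb{R}\setminus\mathbb{Q})$ is a straight brush if (i) $B$ is closed in $\mathbb{R}^2$; (ii) for each $(x,y)\in B$ there is $t_y\ge 0$ with $\{x:(x,y)\in B\}=[t_y,+\infty)$; (iii) the set $Y=\{y:(x,y)\in B\text{ for some }x\}$ is dense in $\mathbb{R}\setminus\mathbb{Q}$, and for each $y\in Y$ there are sequences $\beta_n,\gamma_n\in Y$ with $\beta_n<y<\gamma_n$, $\beta_n,\gamma_n\to y$ and $t_{\beta_n},t_{\gamma_n}\to t_y$. A Cantor bouquet is a subset $X$ of the plane for which some homeomorphism $\mathbb{C}\to\mathbb{R}^2$ maps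 $X$ onto a straight brush. Suppose that $J_R(f)$ is a Cantor bouquet for some $R\ge 0$. Then $f$ is criniferous; that is, for every $z\in I(f)$ there are $N\in\mathbb{N}$ and, for each $n\ge N$, an arc $\gamma_n$ connecting $f^n(z)$ to $\infty$, such that $f$ maps $\gamma_n$ injectively onto $\gamma_{n+1}$ for each $n\ge N$, and $\min_{w\in\gamma_n}|w|\to\infty$ as $n\to\infty$. -/

import Mathlib

open Set Filter Topology

/-! ### Transcendental entire functions and the Eremenko–Lyubich class -/

/-- `f : ℂ → ℂ` is entire and is not a polynomial. -/
def IsTranscendentalEntire (f : ℂ → ℂ) : Prop :=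
  Differentiable ℂ f ∧ ¬ ∃ p : Polynomial ℂ, ∀ z, f z = p.eval z

/-- The critical values of `f`. -/
def criticalValues (f : ℂ → ℂ) : Set ℂ :=
  f '' {z | deriv f z = 0}

/-- The (finite) asymptotic values of `f`: limits of `f` along curves that tend to `∞`. -/
def asymptoticValues (f : ℂ → ℂ) : Set ℂ :=
  {a | ∃ γ : NNReal → ℂ, Continuous γ ∧ Tendsto γ atTop (cocompact ℂ) ∧
    Tendsto (fun t => f (γ t)) atTop (𝓝 a)}

/-- The singular set `S(f)`: the closure of the set of critical and asymptotic values. -/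
def singularSet (f : ℂ → ℂ) : Set ℂ :=
  closure (criticalValues f ∪ asymptoticValues f)

/-- The Eremenko–Lyubich class `𝓑`. -/
def EremenkoLyubichClass : Set (ℂ → ℂ) :=
  {f | IsTranscendentalEntire f ∧ Bornology.IsBounded (singularSet f)}

/-! ### Fatou, Julia and escaping sets -/

/-- The sequence `F` converges to `∞` locally uniformly on the open set `U`. -/
def TendstoInftyLocallyUniformlyOn (F : ℕ → ℂ → ℂ) (U : Set ℂ) : Prop :=
  ∀ K ⊆ U, IsCompact K → ∀ M : ℝ, ∀ᶠ k in atTop, ∀ w ∈ K, M ≤ ‖F k w‖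

/-- A family of functions is normal on the domain `U`: each sequence of its members has a
subsequence that converges, locally uniformly on `U`, either to a finite function or to `∞`. -/
def IsNormalFamilyOn (𝓕 : Set (ℂ → ℂ)) (U : Set ℂ) : Prop :=
  ∀ F : ℕ → ℂ → ℂ, (∀ k, F k ∈ 𝓕) → ∃ φ : ℕ → ℕ, StrictMono φ ∧
    ((∃ g : ℂ → ℂ, TendstoLocallyUniformlyOn (fun k => F (φ k)) g atTop U) ∨
      TendstoInftyLocallyUniformlyOn (fun k => F (φ k)) U)

/-- The Fatou set `F(f)`: the points with a neighbourhood on which the iterates of `f` form a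
normal family. -/
def fatouSet (f : ℂ → ℂ) : Set ℂ :=
  {z | ∃ U : Set ℂ, IsOpen U ∧ IsConnected U ∧ z ∈ U ∧
    IsNormalFamilyOn (range fun n : ℕ => f^[n]) U}

/-- The Julia set `J(f)`. -/
def juliaSet (f : ℂ → ℂ) : Set ℂ := (fatouSet f)ᶜ

/-- The escaping set `I(f)`. -/
def escapingSet (f : ℂ → ℂ) : Set ℂ :=
  {z | Tendsto (fun n : ℕ => f^[n] z) atTop (cocompact ℂ)}

/-- `J_R(f) = {z ∈ J(f) : |fⁿ(z)| ≥ R for all n ≥ 1}`. -/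
def juliaSetOutside (f : ℂ → ℂ) (R : ℝ) : Set ℂ :=
  {z | z ∈ juliaSet f ∧ ∀ n : ℕ, 1 ≤ n → R ≤ ‖f^[n] z‖}

/-! ### Straight brushes and Cantor bouquets -/

/-- The ordinates at which hairs of `B` are attached. -/
def hairOrdinates (B : Set (ℝ × ℝ)) : Set ℝ := {y | ∃ x, (x, y) ∈ B}

/-- `B` is a straight brush. In the last clause `t y` is the abscissa of the endpoint of the hair
attached at `y`. -/
def IsStraightBrush (B : Set (ℝ × ℝ)) : Prop :=
  (∀ p ∈ B, 0 ≤ p.1 ∧ Irrational p.2) ∧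
  IsClosed B ∧
  {y : ℝ | Irrational y} ⊆ closure (hairOrdinates B) ∧
  ∃ t : ℝ → ℝ,
    (∀ y ∈ hairOrdinates B, 0 ≤ t y ∧ {x | (x, y) ∈ B} = Ici (t y)) ∧
    (∀ y ∈ hairOrdinates B, ∃ β γ : ℕ → ℝ,
      (∀ n, β n ∈ hairOrdinates B ∧ β n < y) ∧ (∀ n, γ n ∈ hairOrdinates B ∧ y < γ n) ∧
      Tendsto β atTop (𝓝 y) ∧ Tendsto γ atTop (𝓝 y) ∧
      Tendsto (fun n => t (β n)) atTop (𝓝 (t y)) ∧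
      Tendsto (fun n => t (γ n)) atTop (𝓝 (t y)))

/-- A Cantor bouquet: a subset of the plane ambiently homeomorphic to a straight brush. -/
def IsCantorBouquet (X : Set ℂ) : Prop :=
  ∃ B : Set (ℝ × ℝ), IsStraightBrush B ∧ ∃ h : ℂ ≃ₜ ℝ × ℝ, h '' X = B

/-! ### Criniferous functions -/

/-- `Γ` is (the finite part of) an arc that connects the point `p` to `∞`. -/
def IsArcToInfty (Γ : Set ℂ) (p : ℂ) : Prop :=
  ∃ c : NNReal → ℂ, Continuous c ∧ Function.Injective c ∧ c 0 = p ∧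
    Tendsto c atTop (cocompact ℂ) ∧ range c = Γ

/-- `f` is criniferous: for every escaping point `z` and all sufficiently large `n` there is an arc
`Γ n` connecting `fⁿ(z)` to `∞`, such that `f` maps `Γ n` injectively onto `Γ (n + 1)` and
`min_{w ∈ Γ n} |w| → ∞` as `n → ∞`. -/
def IsCriniferous (f : ℂ → ℂ) : Prop :=
  ∀ z ∈ escapingSet f, ∃ (N : ℕ) (Γ : ℕ → Set ℂ),
    (∀ n ≥ N, IsArcToInfty (Γ n) (f^[n] z) ∧ InjOn f (Γ n) ∧ f '' Γ n = Γ (n + 1)) ∧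
    ∀ M : ℝ, ∀ᶠ n in atTop, ∀ w ∈ Γ n, M ≤ ‖w‖

/-! Let `h` carry J_R(f) onto a straight brush. An escaping point lies in J(f), so its late iterates
lie in J_R(f), hence on hairs. The arc at fⁿ(z) is the part of its hair from fⁿ(z) outwards
(`hairTail`). Abscissae are nonnegative and grow along a tail while the ordinate is fixed, so these
tails tend to ∞ uniformly with n (`exists_forall_le_norm_hairTail`).

For the mapping property, the tail at fⁿ⁺¹(z) lies outside a disc containing S(f), so it lifts
through f to an arc from fⁿ(z) to ∞ (`exists_lift_of_lt_norm`). Backward invariance keeps the lift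
in J_R(f). Ordinates in the brush are irrational, so a connected set cannot change hair, and the
lift is exactly the tail at fⁿ(z) (`injOn_and_image_hairTail`).

The analytic input is I(f) ⊆ J(f) (`escapingSet_subset_juliaSet`). Inverse branches of f in the
coordinate ζ = log f are injective, since a periodic branch would force f to be a polynomial
(`injOn_inverse_branch`). A Bloch-type argument then gives logarithmic expansion
(`log_norm_sub_le_of_lt_norm`), which is incompatible with normality along an escaping orbit. -/

/-! ### Lifting through local homeomorphisms -/

section Lifting

variable {E X : Type*} [TopologicalSpace E]

/-- The path `γ` has a lift through `p` on `[0, T]` that starts at `e`. -/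
def HasLiftUpTo (p : E → X) (γ : ℝ → X) (e : E) (T : ℝ) : Prop :=
  ∃ σ : ℝ → E, ContinuousOn σ (Icc 0 T) ∧ σ 0 = e ∧ ∀ t ∈ Icc 0 T, p (σ t) = γ t

theorem HasLiftUpTo.mono {p : E → X} {γ : ℝ → X} {e : E} {T T' : ℝ} (h : HasLiftUpTo p γ e T)
    (hT : T' ≤ T) : HasLiftUpTo p γ e T' := by
  obtain ⟨σ, h1, h2, h3⟩ := h
  exact ⟨σ, h1.mono (Icc_subset_Icc_right hT), h2, fun t ht => h3 t ⟨ht.1, ht.2.trans hT⟩⟩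

variable [TopologicalSpace X]

/-- Partial lifts through `p` of paths in `A` do not run to infinity in finite time. -/
def PartialLiftsCluster (p : E → X) (A : Set X) : Prop :=
  ∀ (γ : ℝ → X) (σ : ℝ → E) (T : ℝ), Continuous γ → (∀ t, γ t ∈ A) → 0 < T → ContinuousOn σ (Ico 0 T) →
    (∀ t ∈ Ico 0 T, p (σ t) = γ t) → ∃ e, MapClusterPt e (𝓝[<] T) σ

/-- A lift can be prolonged inside the domain of a local section. -/
theorem HasLiftUpTo.prolong {p : E → X} {γ : ℝ → X} (hγ : Continuous γ) {t t' : ℝ} {σ : ℝ → E}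
    (ht : 0 ≤ t) (h1 : ContinuousOn σ (Icc 0 t)) (h3 : ∀ s ∈ Icc 0 t, p (σ s) = γ s)
    (q : OpenPartialHomeomorph E X) (hq : p = q) (hs : σ t ∈ q.source)
    (htar : ∀ s ∈ Icc t t', γ s ∈ q.target) : HasLiftUpTo p γ (σ 0) t' := by
  have hσt : q.symm (γ t) = σ t := by
    rw [← h3 t ⟨ht, le_rfl⟩, hq]; exact q.left_inv hs
  refine ⟨fun s => if s ≤ t then σ s else q.symm (γ s), ?_, if_pos ht, ?_⟩
  · refine ContinuousOn.if ?_ ?_ ?_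
    · rintro s ⟨-, hs2⟩
      have : s = t := frontier_Iic_subset _ hs2
      rw [this, hσt]
    · refine h1.mono ?_
      rintro s ⟨hs1, hs2⟩
      exact ⟨hs1.1, by simpa [show closure {a | a ≤ t} = Iic t from closure_Iic t] using hs2⟩
    · refine (q.continuousOn_invFun.comp hγ.continuousOn ?_)
      rintro s ⟨hs1, hs2⟩
      refine htar s ⟨?_, hs1.2⟩
      have : {a | ¬ a ≤ t} = Ioi t := by ext; simp
      rw [this, closure_Ioi] at hs2
      exact hs2
  · intro s hs'
    dsimp only
    split_ifs with h
    · exact h3 s ⟨hs'.1, h⟩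
    · rw [hq]; exact q.right_inv (htar s ⟨le_of_not_ge h, hs'.2⟩)

variable [T2Space X]

/-- Paths lift through a separated local homeomorphism whose partial lifts cluster. -/
theorem IsLocalHomeomorph.hasLiftUpTo {p : E → X} (hp : IsLocalHomeomorph p)
    (sep : IsSeparatedMap p) {A : Set X} (hcl : PartialLiftsCluster p A) {γ : ℝ → X} (hγ : Continuous γ)
    (hγA : ∀ t, γ t ∈ A) {e : E}
    (he : p e = γ 0) (T : ℝ) : HasLiftUpTo p γ e T := by
  by_contra hT
  set S : Set ℝ := {t | HasLiftUpTo p γ e t}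
  have h0 : (0 : ℝ) ∈ S := by
    refine ⟨fun _ => e, continuousOn_const, rfl, fun t ht => ?_⟩
    obtain rfl : t = 0 := le_antisymm ht.2 ht.1
    exact he
  have hbdd : BddAbove S := ⟨T, fun t ht => le_of_not_gt fun h => hT (HasLiftUpTo.mono ht h.le)⟩
  set c := sSup S
  have hc0 : 0 ≤ c := le_csSup hbdd h0
  have hcS : c ∉ S := by
    rintro ⟨σ, h1, h2, h3⟩
    obtain ⟨q, hq1, hq2⟩ := hp (σ c)
    have hmem : γ c ∈ q.target := by
      rw [← h3 c ⟨hc0, le_rfl⟩, hq2]; exact q.map_source hq1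
    obtain ⟨ε, hε, hball⟩ := Metric.mem_nhds_iff.1
      ((q.open_target.preimage hγ).mem_nhds hmem)
    have := HasLiftUpTo.prolong (t' := c + ε / 2) hγ hc0 h1 h3 q hq2 hq1 (fun s hs => hball (by
      rw [Metric.mem_ball, Real.dist_eq, abs_lt]; constructor <;> linarith [hs.1, hs.2]))
    rw [h2] at this
    linarith [le_csSup hbdd this]
  have hlt : ∀ t < c, HasLiftUpTo p γ e t := fun t ht => by
    obtain ⟨s, hs, hts⟩ := exists_lt_of_lt_csSup ⟨0, h0⟩ ht
    exact HasLiftUpTo.mono hs hts.le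
  have hcpos : 0 < c := lt_of_le_of_ne hc0 fun h => hcS (h ▸ h0)
  have : Nonempty E := ⟨e⟩
  choose! τ hτ1 hτ2 hτ3 using hlt
  have huniq : ∀ s t u, 0 ≤ u → u ≤ s → u ≤ t → s < c → t < c → τ s u = τ t u := by
    intro s t u hu hus hut hs ht
    exact sep.eqOn_of_comp_eqOn hp.isLocallyInjective (isPreconnected_Icc (a := 0) (b := u))
      ((hτ1 s hs).mono (Icc_subset_Icc_right hus)) ((hτ1 t ht).mono (Icc_subset_Icc_right hut))
      (fun v hv => by
        simp only [Function.comp]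
        rw [hτ3 s hs v ⟨hv.1, hv.2.trans hus⟩, hτ3 t ht v ⟨hv.1, hv.2.trans hut⟩])
      ⟨le_rfl, hu⟩ (by rw [hτ2 s hs, hτ2 t ht]) ⟨hu, le_rfl⟩
  -- Using the lift up to the midpoint of s and c makes σ agree with a single continuous lift near
  -- each s < c.
  set σ : ℝ → E := fun s => τ ((s + c) / 2) s
  have hστ : ∀ t < c, EqOn σ (τ t) (Icc 0 t) := fun t ht u hu =>
    huniq _ _ _ hu.1 (by linarith [hu.2]) hu.2 (by linarith [hu.2]) ht
  have hσc : ContinuousOn σ (Ico 0 c) := by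
    intro u hu
    have h' : (u + c) / 2 < c := by linarith [hu.2]
    have := ((hτ1 _ h').congr (hστ _ h')) u ⟨hu.1, by linarith [hu.2]⟩
    refine this.mono_of_mem_nhdsWithin ?_
    have : Iio ((u + c) / 2) ∈ 𝓝 u := Iio_mem_nhds (by linarith [hu.2])
    filter_upwards [nhdsWithin_le_nhds this, self_mem_nhdsWithin] with v hv hv2
    exact ⟨hv2.1, le_of_lt hv⟩
  have hσl : ∀ t ∈ Ico 0 c, p (σ t) = γ t := fun t ht => by
    rw [hστ t ht.2 ⟨ht.1, le_rfl⟩]; exact hτ3 t ht.2 t ⟨ht.1, le_rfl⟩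
  have hσ0 : σ 0 = e := by rw [hστ 0 hcpos ⟨le_rfl, le_rfl⟩]; exact hτ2 0 hcpos
  obtain ⟨x, hx⟩ := hcl γ σ c hγ hγA hcpos hσc hσl
  obtain ⟨q, hq1, hq2⟩ := hp x
  have hpx : p x = γ c := by
    have h1 : MapClusterPt (p x) (𝓝[<] c) (p ∘ σ) := hx.continuousAt_comp hp.continuous.continuousAt
    have h2 : Tendsto (p ∘ σ) (𝓝[<] c) (𝓝 (γ c)) := by
      refine ((hγ.tendsto c).mono_left nhdsWithin_le_nhds).congr' ?_
      filter_upwards [Ico_mem_nhdsLT hcpos] with t ht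
      exact (hσl t ht).symm
    have h3 : (𝓝 (p x) ⊓ 𝓝 (γ c)).NeBot := h1.neBot.mono (inf_le_inf_left _ h2)
    exact eq_of_nhds_neBot h3
  have hmem : γ c ∈ q.target := by
    rw [← hpx, hq2]; exact q.map_source hq1
  obtain ⟨ε, hε, hball⟩ := Metric.mem_nhds_iff.1
    ((q.open_target.preimage hγ).mem_nhds hmem)
  -- Only a cluster point is available, but the lift enters the domain of the local section at times
  -- arbitrarily close to c. From such a time the section carries it to c.
  have hfr : ∃ᶠ t in 𝓝[<] c, σ t ∈ q.source := hx.frequently (q.open_source.mem_nhds hq1)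
  obtain ⟨t, ht1, ht2, ht3⟩ := (hfr.and_eventually (Filter.inter_mem (Ico_mem_nhdsLT hcpos)
    (Ico_mem_nhdsLT (show c - ε / 2 < c by linarith)))).exists
  have := HasLiftUpTo.prolong (t' := c) hγ ht2.1
    (hσc.mono fun s hs => ⟨hs.1, hs.2.trans_lt ht2.2⟩)
    (fun s hs => hσl s ⟨hs.1, hs.2.trans_lt ht2.2⟩) q hq2 ht1 (fun s hs => hball (by
      rw [Metric.mem_ball, Real.dist_eq, abs_lt]; constructor <;> linarith [hs.1, hs.2, ht3.1]))
  rw [hσ0] at this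
  exact hcS this

/-- Maps from a space that contracts to `y₀` lift through a separated local homeomorphism whose
partial lifts cluster. -/
theorem IsLocalHomeomorph.exists_lift_of_contraction {p : E → X} (hp : IsLocalHomeomorph p)
    (sep : IsSeparatedMap p) {A : Set X} (hcl : PartialLiftsCluster p A) {Y : Type*} [TopologicalSpace Y]
    {y₀ : Y} (H : unitInterval × Y → Y) (hH : Continuous H) (h0 : ∀ y, H (0, y) = y₀)
    (h1 : ∀ y, H (1, y) = y) (h2 : ∀ t, H (t, y₀) = y₀) {g : Y → X} (hg : Continuous g)
    (hgA : ∀ y, g y ∈ A) {e : E} (he : p e = g y₀) :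
    ∃ G : Y → E, Continuous G ∧ G y₀ = e ∧ ∀ y, p (G y) = g y := by
  have hpath : ∀ y, HasLiftUpTo p
      (fun t => g (H (projIcc (0 : ℝ) 1 zero_le_one t, y))) e 1 := fun y =>
    hp.hasLiftUpTo sep hcl (by fun_prop) (fun t => hgA _) (by
      rw [he]; congr 1; rw [← h0 y]; congr 2; exact (projIcc_left zero_le_one).symm) 1
  choose σ hσ1 hσ2 hσ3 using hpath
  have hlift : ∀ y (t : unitInterval), p (σ y t) = g (H (t, y)) := fun y t => by
    rw [hσ3 y t t.2]; dsimp only; rw [projIcc_val]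
  have hcont : Continuous fun ty : unitInterval × Y => σ ty.2 ty.1 :=
    hp.continuous_lift sep ⟨fun ty => g (H ty), hg.comp hH⟩
      (funext fun ty => hlift ty.2 ty.1) (by simpa [hσ2] using continuous_const)
      (fun y => (hσ1 y).comp_continuous continuous_subtype_val fun t => t.2)
  refine ⟨fun y => σ y 1, hcont.comp (Continuous.prodMk_right (1 : unitInterval)), ?_, fun y => ?_⟩
  -- The contraction fixes `y₀`, so the path lifted there is constant, and so is its lift.
  · have hc : Continuous fun t : unitInterval => σ y₀ t :=
      hcont.comp (Continuous.prodMk_left y₀)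
    rw [← hσ2 y₀]
    exact sep.const_of_comp hp.isLocallyInjective hc (fun a b => by
      rw [hlift, hlift, h2, h2]) 1 0
  · have := hlift y 1
    rw [h1] at this
    exact this

end Lifting

/-! ### Lifting through `f` outside a disc that contains the singular set -/

theorem deriv_ne_zero_of_lt_norm {f : ℂ → ℂ} {ρ : ℝ} (hρ : ∀ s ∈ singularSet f, ‖s‖ ≤ ρ) {z : ℂ}
    (hz : ρ < ‖f z‖) : deriv f z ≠ 0 := fun h =>
  absurd (hρ (f z) (subset_closure (Or.inl ⟨z, h, rfl⟩))) (not_le.2 hz)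

theorem isLocalHomeomorph_restrict {f : ℂ → ℂ} (hf : Differentiable ℂ f) {ρ : ℝ}
    (hρ : ∀ s ∈ singularSet f, ‖s‖ ≤ ρ) :
    IsLocalHomeomorph fun z : {z | ρ < ‖f z‖} => f z := by
  have hopen : IsOpen {z | ρ < ‖f z‖} := isOpen_lt continuous_const hf.continuous.norm
  have h1 : IsLocalHomeomorphOn f {z | ρ < ‖f z‖} := by
    intro z hz
    have hs : HasStrictDerivAt f (deriv f z) z :=
      ((hf.analyticAt z).contDiffAt (n := 1)).hasStrictDerivAt one_ne_zero
    have hs' := hs.hasStrictFDerivAt_equiv (deriv_ne_zero_of_lt_norm hρ hz)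
    exact ⟨hs'.toOpenPartialHomeomorph f, hs'.mem_toOpenPartialHomeomorph_source, rfl⟩
  rw [isLocalHomeomorph_iff_isLocalHomeomorphOn_univ]
  exact h1.comp (hopen.isOpenEmbedding_subtypeVal.isLocalHomeomorph.isLocalHomeomorphOn)
    fun z _ => z.2

/-- A partial lift escaping to ∞ as t → T would make γ(T) an asymptotic value of modulus greater
than ρ. Otherwise it clusters at a finite w with f(w) = γ(T), and such a w lies in the restricted
domain. -/
theorem partialLiftsCluster_restrict {f : ℂ → ℂ} (hf : Differentiable ℂ f) {ρ : ℝ}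
    (hρ : ∀ s ∈ singularSet f, ‖s‖ ≤ ρ) :
    PartialLiftsCluster (fun z : {z | ρ < ‖f z‖} => f z) {w | ρ < ‖w‖} := by
  intro γ σ T hγ hγA hT hσ hl
  have hγT : ρ < ‖γ T‖ := hγA T
  have hγlim : Tendsto (fun t => f (σ t)) (𝓝[<] T) (𝓝 (γ T)) := by
    refine ((hγ.tendsto T).mono_left nhdsWithin_le_nhds).congr' ?_
    filter_upwards [Ico_mem_nhdsLT hT] with t ht
    exact (hl t ht).symm
  have hnot : ¬ Tendsto (fun t => (σ t : ℂ)) (𝓝[<] T) (cocompact ℂ) := by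
    intro hinf
    -- The map s ↦ T·s/(1+s) reparametrises [0, T) by [0, ∞), as the definition of asymptotic values
    -- demands.
    have hmem : ∀ s : NNReal, T * (s / (1 + s)) ∈ Ico 0 T := fun s => by
      have h1 : (0 : ℝ) < 1 + s := by positivity
      refine ⟨by positivity, ?_⟩
      have : (s : ℝ) / (1 + s) < 1 := by rw [div_lt_one h1]; linarith
      nlinarith
    have hcont : Continuous fun s : NNReal => T * ((s : ℝ) / (1 + s)) := by
      refine continuous_const.mul (Continuous.div (by fun_prop) (by fun_prop) fun s => ?_)
      positivity
    have hlim : Tendsto (fun s : NNReal => T * ((s : ℝ) / (1 + s))) atTop (𝓝[<] T) := by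
      refine tendsto_nhdsWithin_iff.2 ⟨?_, Eventually.of_forall fun s => (hmem s).2⟩
      have h1 : Tendsto (fun s : NNReal => T * (1 - (1 + (s : ℝ))⁻¹)) atTop (𝓝 (T * (1 - 0))) := by
        refine Tendsto.const_mul _ (tendsto_const_nhds.sub ?_)
        exact tendsto_inv_atTop_zero.comp
          (tendsto_atTop_add_const_left _ _ (NNReal.tendsto_coe_atTop.2 tendsto_id))
      rw [sub_zero, mul_one] at h1
      refine h1.congr fun s => ?_
      have : (1 + (s : ℝ)) ≠ 0 := by positivity
      field_simp
      ring
    have hasym : γ T ∈ asymptoticValues f :=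
      ⟨fun s => σ (T * (s / (1 + s))),
        continuous_subtype_val.comp (hσ.comp_continuous hcont hmem), hinf.comp hlim,
        hγlim.comp hlim⟩
    exact absurd (hρ _ (subset_closure (Or.inr hasym))) (not_le.2 hγT)
  rw [← coclosedCompact_eq_cocompact] at hnot
  rw [(hasBasis_coclosedCompact).tendsto_right_iff] at hnot
  push Not at hnot
  obtain ⟨K, ⟨-, hK⟩, hfr⟩ := hnot
  obtain ⟨w, -, hw⟩ := hK.exists_mapClusterPt_of_frequently (l := 𝓝[<] T)
    (f := fun t => (σ t : ℂ)) (hfr.mono fun t ht => by simpa using ht)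
  have hfw : f w = γ T := by
    have h1 : MapClusterPt (f w) (𝓝[<] T) (fun t => f (σ t)) :=
      hw.continuousAt_comp hf.continuous.continuousAt
    have h3 : (𝓝 (f w) ⊓ 𝓝 (γ T)).NeBot := h1.neBot.mono (inf_le_inf_left _ hγlim)
    exact eq_of_nhds_neBot h3
  have hwE : w ∈ {z | ρ < ‖f z‖} := by rw [mem_ofPred_eq, hfw]; exact hγT
  refine ⟨⟨w, hwE⟩, ?_⟩
  rw [mapClusterPt_iff_frequently] at hw ⊢
  intro s hs
  obtain ⟨u, hu, hus⟩ := mem_nhds_subtype _ _ _ |>.1 hs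
  exact (hw u hu).mono fun t ht => hus ht

/-- Maps of a contractible space into the complement of a disc containing the singular set lift
through `f`. -/
theorem exists_lift_of_lt_norm {f : ℂ → ℂ} (hf : Differentiable ℂ f) {ρ : ℝ}
    (hρ : ∀ s ∈ singularSet f, ‖s‖ ≤ ρ) {Y : Type*} [TopologicalSpace Y]
    {y₀ : Y} (H : unitInterval × Y → Y) (hH : Continuous H) (h0 : ∀ y, H (0, y) = y₀)
    (h1 : ∀ y, H (1, y) = y) (h2 : ∀ t, H (t, y₀) = y₀) {g : Y → ℂ} (hg : Continuous g)
    (hgρ : ∀ y, ρ < ‖g y‖) {z : ℂ} (hz : f z = g y₀) :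
    ∃ G : Y → ℂ, Continuous G ∧ G y₀ = z ∧ ∀ y, f (G y) = g y := by
  have hzE : ρ < ‖f z‖ := hz ▸ hgρ y₀
  obtain ⟨G, hG, hG0, hGl⟩ := (isLocalHomeomorph_restrict hf hρ).exists_lift_of_contraction
    (T2Space.isSeparatedMap _) (partialLiftsCluster_restrict hf hρ) H hH h0 h1 h2 hg hgρ
    (e := ⟨z, hzE⟩) hz
  exact ⟨fun y => G y, continuous_subtype_val.comp hG, by simp [hG0], hGl⟩

/-- The half-plane is convex, so exp lifts through f. The lift is locally a holomorphic inverse of f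
composed with exp. -/
theorem exists_inverse_branch {f : ℂ → ℂ} (hf : Differentiable ℂ f) {l : ℝ}
    (hρ : ∀ s ∈ singularSet f, ‖s‖ ≤ Real.exp l) {z ζ₀ : ℂ} (hζ₀ : l < ζ₀.re)
    (hz : f z = Complex.exp ζ₀) :
    ∃ φ : ℂ → ℂ, DifferentiableOn ℂ φ {ζ | l < ζ.re} ∧ φ ζ₀ = z ∧
      ∀ ζ, l < ζ.re → f (φ ζ) = Complex.exp ζ := by
  have hconv : Convex ℝ {ζ : ℂ | l < ζ.re} := convex_halfSpace_re_gt l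
  have hopen : IsOpen {ζ : ℂ | l < ζ.re} := isOpen_lt continuous_const Complex.continuous_re
  obtain ⟨G, hG, hG0, hGl⟩ := exists_lift_of_lt_norm hf hρ (Y := {ζ : ℂ | l < ζ.re})
    (y₀ := ⟨ζ₀, hζ₀⟩)
    (fun x => ⟨ζ₀ + (x.1 : ℝ) • ((x.2 : ℂ) - ζ₀),
      hconv.add_smul_sub_mem hζ₀ x.2.2 x.1.2⟩) (by fun_prop) (by simp) (by simp) (by simp)
    (g := fun ζ => Complex.exp ζ) (by fun_prop)
    (fun ζ => by rw [Complex.norm_exp]; exact Real.exp_lt_exp.2 ζ.2) hz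
  classical
  set φ : ℂ → ℂ := fun ζ => if h : l < ζ.re then G ⟨ζ, h⟩ else 0
  have hφ : ∀ ζ (h : l < ζ.re), φ ζ = G ⟨ζ, h⟩ := fun ζ h => dif_pos h
  have hφl : ∀ ζ, l < ζ.re → f (φ ζ) = Complex.exp ζ := fun ζ h => by rw [hφ ζ h, hGl]
  have hcont : ContinuousOn φ {ζ | l < ζ.re} := by
    rw [continuousOn_iff_continuous_domRestrict]
    exact hG.congr fun x => (hφ x x.2).symm
  refine ⟨φ, fun ζ hζ => DifferentiableAt.differentiableWithinAt ?_, by rw [hφ ζ₀ hζ₀, hG0], hφl⟩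
  have hcζ : ContinuousAt φ ζ := hcont.continuousAt (hopen.mem_nhds hζ)
  have hs : HasStrictDerivAt f (deriv f (φ ζ)) (φ ζ) :=
    ((hf.analyticAt _).contDiffAt (n := 1)).hasStrictDerivAt one_ne_zero
  have hne : deriv f (φ ζ) ≠ 0 := deriv_ne_zero_of_lt_norm hρ (by
    rw [hφl ζ hζ, Complex.norm_exp]; exact Real.exp_lt_exp.2 hζ)
  have hev : ∀ᶠ ζ' in 𝓝 ζ, hs.localInverse f _ _ hne (Complex.exp ζ') = φ ζ' := by
    filter_upwards [hcζ.eventually (hs.hasStrictFDerivAt_equiv hne).eventually_left_inverse,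
      hopen.mem_nhds hζ] with ζ' h1 h2
    rw [← hφl ζ' h2]
    exact h1
  have hd : DifferentiableAt ℂ (fun ζ' => hs.localInverse f _ _ hne (Complex.exp ζ')) ζ := by
    refine DifferentiableAt.comp ζ ?_ Complex.differentiableAt_exp
    rw [← hφl ζ hζ]
    exact (hs.to_localInverse hne).hasDerivAt.differentiableAt
  exact hd.congr_of_eventuallyEq (hev.mono fun _ h => h.symm)

/-! ### Inverse branches of `f` over half-planes are injective -/

/-- An entire function of polynomial growth is a polynomial. -/
theorem exists_polynomial_of_growth {f : ℂ → ℂ} (hf : Differentiable ℂ f) {C r : ℝ} {n : ℕ}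
    (h : ∀ z, r ≤ ‖z‖ → ‖f z‖ ≤ C * ‖z‖ ^ n) : ∃ p : Polynomial ℂ, ∀ z, f z = p.eval z := by
  -- Cauchy's estimates on circles of radius s → ∞.
  have hzero : ∀ m, n < m → iteratedDeriv m f 0 = 0 := by
    intro m hm
    have hb : ∀ᶠ s : ℝ in atTop, ‖iteratedDeriv m f 0‖ ≤ (m.factorial * C) * (s ^ (m - n))⁻¹ := by
      filter_upwards [eventually_ge_atTop r, eventually_gt_atTop 0] with s hs hs0
      have := Complex.norm_iteratedDeriv_le_of_forall_mem_sphere_norm_le (f := f) (c := 0) m hs0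
        hf.diffContOnCl (C := C * s ^ n) (fun z hz => by
          have hz' : ‖z‖ = s := by simpa using hz
          rw [← hz']; exact h z (hz' ▸ hs))
      refine this.trans (le_of_eq ?_)
      have : s ^ m = s ^ n * s ^ (m - n) := by rw [← pow_add]; congr 1; omega
      rw [this]
      field_simp
    have hlim : Tendsto (fun s : ℝ => (m.factorial * C) * (s ^ (m - n))⁻¹) atTop (𝓝 0) := by
      have := ((tendsto_pow_atTop (α := ℝ) (n := m - n) (by omega)).inv_tendsto_atTop).const_mul
        (m.factorial * C)
      simpa using this
    exact norm_le_zero_iff.1 (ge_of_tendsto hlim hb)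
  refine ⟨∑ m ∈ Finset.range (n + 1),
    Polynomial.monomial m ((m.factorial : ℂ)⁻¹ * iteratedDeriv m f 0), fun z => ?_⟩
  have h1 := Complex.hasSum_taylorSeries_of_entire hf 0 z
  have h2 := h1.unique (hasSum_sum_of_ne_finset_zero (s := Finset.range (n + 1)) fun m hm => by
    rw [hzero m (by simpa using hm)]; simp)
  rw [h2, Polynomial.eval_finsetSum]
  refine Finset.sum_congr rfl fun m _ => ?_
  simp
  ring

/-- The translate of φ by a period of exp is again a lift of exp. Since f is locally injective at
φ(ζ₁), the two lifts agree near ζ₁, hence everywhere by the identity theorem. -/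
theorem inverse_branch_periodic {f : ℂ → ℂ} (hf : Differentiable ℂ f) {l : ℝ}
    (hρ : ∀ s ∈ singularSet f, ‖s‖ ≤ Real.exp l) {φ : ℂ → ℂ}
    (hφ : DifferentiableOn ℂ φ {ζ | l < ζ.re})
    (hφl : ∀ ζ, l < ζ.re → f (φ ζ) = Complex.exp ζ) {ζ₁ : ℂ} (hζ₁ : l < ζ₁.re) {k : ℤ}
    (heq : φ (ζ₁ + k * (2 * Real.pi * Complex.I)) = φ ζ₁) :
    ∀ ζ, l < ζ.re → φ (ζ + k * (2 * Real.pi * Complex.I)) = φ ζ := by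
  have hconv : Convex ℝ {ζ : ℂ | l < ζ.re} := convex_halfSpace_re_gt l
  have hopen : IsOpen {ζ : ℂ | l < ζ.re} := isOpen_lt continuous_const Complex.continuous_re
  set τ : ℂ := k * (2 * Real.pi * Complex.I) with hτ
  have hre : ∀ ζ : ℂ, (ζ + τ).re = ζ.re := fun ζ => by simp [hτ]
  have hexp : ∀ ζ, Complex.exp (ζ + τ) = Complex.exp ζ := fun ζ => by
    rw [hτ, Complex.exp_periodic.int_mul k ζ]
  have hφτ : DifferentiableOn ℂ (fun ζ => φ (ζ + τ)) {ζ | l < ζ.re} :=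
    hφ.comp (by fun_prop) fun ζ hζ => by rw [mem_ofPred_eq, hre]; exact hζ
  have hs : HasStrictDerivAt f (deriv f (φ ζ₁)) (φ ζ₁) :=
    ((hf.analyticAt _).contDiffAt (n := 1)).hasStrictDerivAt one_ne_zero
  have hne : deriv f (φ ζ₁) ≠ 0 := deriv_ne_zero_of_lt_norm hρ (by
    rw [hφl ζ₁ hζ₁, Complex.norm_exp]; exact Real.exp_lt_exp.2 hζ₁)
  have hc1 : ContinuousAt φ ζ₁ := hφ.continuousOn.continuousAt (hopen.mem_nhds hζ₁)
  have hc2 : Tendsto (fun ζ => φ (ζ + τ)) (𝓝 ζ₁) (𝓝 (φ ζ₁)) := by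
    conv_rhs => rw [← heq]
    exact hφτ.continuousOn.continuousAt (hopen.mem_nhds hζ₁)
  have hinv := (hs.hasStrictFDerivAt_equiv hne).eventually_left_inverse
  have hev : (fun ζ => φ (ζ + τ)) =ᶠ[𝓝 ζ₁] φ := by
    filter_upwards [hc1.eventually hinv, hc2.eventually hinv, hopen.mem_nhds hζ₁] with ζ h1 h2 h3
    have h4 : f (φ (ζ + τ)) = f (φ ζ) := by
      rw [hφl ζ h3, hφl (ζ + τ) (by rw [hre]; exact h3), hexp]
    rw [← h1, ← h4, h2]
  intro ζ hζ
  exact AnalyticOnNhd.eqOn_of_preconnected_of_eventuallyEq (hφτ.analyticOnNhd hopen)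
    (hφ.analyticOnNhd hopen) hconv.isPreconnected hζ₁ hev hζ

/-- Periodicity makes 1/φ a function c of q = exp(-ζ/k), with a removable singularity and a zero at
q = 0. By the open mapping theorem every z of large modulus is 1/c(q) for a small q. From |c(q)| ≤
C|q| follows |f(z)| = |q|⁻ᵏ ≤ (C|z|)ᵏ. The bound on f(0) ensures that φ omits 0. -/
theorem exists_polynomial_of_periodic_inverse_branch {f : ℂ → ℂ} (hf : Differentiable ℂ f) {l : ℝ}
    (hf0 : ‖f 0‖ ≤ Real.exp l) {φ : ℂ → ℂ} (hφ : DifferentiableOn ℂ φ {ζ | l < ζ.re})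
    (hφl : ∀ ζ, l < ζ.re → f (φ ζ) = Complex.exp ζ) {k : ℕ} (hk : 0 < k)
    (hper : ∀ ζ, l < ζ.re → φ (ζ - k * (2 * Real.pi * Complex.I)) = φ ζ) :
    ∃ p : Polynomial ℂ, ∀ z, f z = p.eval z := by
  have hopen : IsOpen {τ : ℂ | l < τ.im} := isOpen_lt continuous_const Complex.continuous_im
  have hφ0 : ∀ ζ, l < ζ.re → φ ζ ≠ 0 := fun ζ hζ h0 => by
    have h1 := hφl ζ hζ
    rw [h0] at h1
    rw [h1, Complex.norm_exp, Real.exp_le_exp] at hf0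
    linarith
  have hre : ∀ τ : ℂ, (-Complex.I * τ).re = τ.im := fun τ => by simp
  classical
  -- The rotation τ = iζ turns the right half-plane into the upper half-plane Im τ > l, where cusp
  -- functions are defined.
  set G : ℂ → ℂ := fun τ => if l < τ.im then (φ (-Complex.I * τ))⁻¹ else 0 with hGdef
  have hG : ∀ τ, l < τ.im → G τ = (φ (-Complex.I * τ))⁻¹ := fun τ h => if_pos h
  set h : ℝ := 2 * Real.pi * k with hh
  have hhpos : 0 < h := by positivity
  have hGper : Function.Periodic G h := by
    intro τ
    have him : (τ + h).im = τ.im := by simp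
    simp only [hGdef, him]
    split_ifs with hτ
    · rw [← hper (-Complex.I * τ) (by rw [hre]; exact hτ)]
      congr 2
      rw [hh]; push_cast; ring
    · rfl
  have hev : ∀ᶠ τ : ℂ in comap Complex.im atTop, l < τ.im :=
    (eventually_gt_atTop l).comap Complex.im
  have hhol : ∀ᶠ τ in comap Complex.im atTop, DifferentiableAt ℂ G τ := by
    filter_upwards [hev] with τ hτ
    have h1 : DifferentiableAt ℂ (fun τ => (φ (-Complex.I * τ))⁻¹) τ := by
      refine DifferentiableAt.inv (DifferentiableAt.comp τ (hφ.differentiableAt ?_) (by fun_prop))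
        (hφ0 _ (by rw [hre]; exact hτ))
      exact (isOpen_lt continuous_const Complex.continuous_re).mem_nhds
        (by rw [mem_ofPred_eq, hre]; exact hτ)
    refine h1.congr_of_eventuallyEq ?_
    filter_upwards [hopen.mem_nhds hτ] with τ' hτ' using hG τ' hτ'
  have hinf : Tendsto (fun τ => φ (-Complex.I * τ)) (comap Complex.im atTop) (cocompact ℂ) := by
    refine Tendsto.mono_right ?_ (comap_cocompact_le hf.continuous)
    rw [tendsto_comap_iff, ← Metric.cobounded_eq_cocompact, ← tendsto_norm_atTop_iff_cobounded]
    refine (Real.tendsto_exp_atTop.comp tendsto_comap).congr' ?_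
    filter_upwards [hev] with τ hτ
    simp only [Function.comp]
    rw [hφl _ (by rw [hre]; exact hτ), Complex.norm_exp, hre]
  have hzer : ZeroAtFilter (comap Complex.im atTop) G := by
    have : Tendsto (fun τ => (φ (-Complex.I * τ))⁻¹) (comap Complex.im atTop) (𝓝 0) := by
      rw [← Metric.cobounded_eq_cocompact] at hinf
      exact tendsto_inv₀_cobounded.comp hinf
    refine this.congr' ?_
    filter_upwards [hev] with τ hτ using (hG τ hτ).symm
  set c := Function.Periodic.cuspFunction h G
  have hc0 : c 0 = 0 := Function.Periodic.cuspFunction_zero_of_zero_at_inf hhpos hzer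
  have hcd : DifferentiableAt ℂ c 0 :=
    Function.Periodic.differentiableAt_cuspFunction_zero hhpos hGper hhol hzer.boundedAtFilter
  have hcd' : ∀ᶠ q in 𝓝 0, DifferentiableAt ℂ c q := by
    have := Function.Periodic.eventually_differentiableAt_cuspFunction_nhds_ne_zero hhpos hGper hhol
    rw [eventually_nhdsWithin_iff] at this
    filter_upwards [this] with q hq
    by_cases hq0 : q = 0
    · rw [hq0]; exact hcd
    · exact hq hq0
  have hinv : ∀ᶠ q in 𝓝[≠] (0 : ℂ), l < (Function.Periodic.invQParam h q).im :=
    (Function.Periodic.invQParam_tendsto hhpos).eventually hev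
  have hcq : ∀ q : ℂ, q ≠ 0 → l < (Function.Periodic.invQParam h q).im →
      c q = (φ (-Complex.I * Function.Periodic.invQParam h q))⁻¹ := fun q hq hq' => by
    rw [← hG _ hq']
    exact Function.Periodic.cuspFunction_eq_of_nonzero _ _ hq
  have hopenmap : 𝓝 (0 : ℂ) ≤ map c (𝓝 0) := by
    have h1 := (Complex.analyticAt_iff_eventually_differentiableAt.2 hcd'
      ).eventually_constant_or_nhds_le_map_nhds
    rw [hc0] at h1
    refine h1.resolve_left fun h2 => ?_
    obtain ⟨q, ⟨h3, h4⟩, h5⟩ := ((h2.filter_mono nhdsWithin_le_nhds).and hinv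
      |>.and self_mem_nhdsWithin).exists (f := 𝓝[≠] (0 : ℂ))
    rw [hcq q h5 h4, inv_eq_zero] at h3
    exact hφ0 _ (by rw [hre]; exact h4) h3
  obtain ⟨C, hC⟩ := hcd.isBigO_sub.bound
  rw [eventually_nhdsWithin_iff] at hinv
  have hV' := (tendsto_inv₀_cobounded (α := ℂ)) (hopenmap (image_mem_map (hC.and hinv)))
  rw [mem_map, hasBasis_cobounded_norm.mem_iff] at hV'
  obtain ⟨r, -, hr⟩ := hV'
  refine exists_polynomial_of_growth hf (C := C ^ k) (r := max r 1) (n := k) fun z hz => ?_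
  obtain ⟨q, ⟨h1, h2⟩, h3⟩ := hr (show r ≤ ‖z‖ from (le_max_left _ _).trans hz)
  have hz1 : 1 ≤ ‖z‖ := (le_max_right _ _).trans hz
  have hz0 : z ≠ 0 := fun h => by rw [h, norm_zero] at hz1; linarith
  have hq0 : q ≠ 0 := fun h => by
    rw [h, hc0] at h3; exact inv_ne_zero hz0 h3.symm
  have him := h2 hq0
  rw [hc0, sub_zero, sub_zero, h3, norm_inv] at h1
  rw [hcq q hq0 him, inv_inj] at h3
  rw [← h3, hφl _ (by rw [hre]; exact him), h3, Complex.norm_exp, hre,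
    Function.Periodic.im_invQParam, hh]
  have hq : 0 < ‖q‖ := norm_pos_iff.2 hq0
  have h4 : Real.exp (-(2 * Real.pi * k) / (2 * Real.pi) * Real.log ‖q‖) = (‖q‖⁻¹) ^ k := by
    rw [show -(2 * Real.pi * k) / (2 * Real.pi) * Real.log ‖q‖ = k * Real.log (‖q‖⁻¹) by
      rw [Real.log_inv]; field_simp, Real.exp_nat_mul, Real.exp_log (inv_pos.2 hq)]
  rw [h4, ← mul_pow]
  gcongr
  have hz' : 0 < ‖z‖ := by linarith
  rw [inv_le_iff_one_le_mul₀ hq]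
  rw [inv_le_iff_one_le_mul₀ hz'] at h1
  linarith

/-- Two points with the same image have the same exponential, so they differ by 2πik. If k ≠ 0, then
φ is periodic and f is a polynomial. -/
theorem injOn_inverse_branch {f : ℂ → ℂ} (hf : IsTranscendentalEntire f) {l : ℝ}
    (hρ : ∀ s ∈ singularSet f, ‖s‖ ≤ Real.exp l) (hf0 : ‖f 0‖ ≤ Real.exp l) {φ : ℂ → ℂ}
    (hφ : DifferentiableOn ℂ φ {ζ | l < ζ.re})
    (hφl : ∀ ζ, l < ζ.re → f (φ ζ) = Complex.exp ζ) : InjOn φ {ζ | l < ζ.re} := by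
  intro ζ₁ h₁ ζ₂ h₂ heq
  by_contra hne
  obtain ⟨k, hk⟩ := Complex.exp_eq_exp_iff_exists_int.1
    (show Complex.exp ζ₂ = Complex.exp ζ₁ by rw [← hφl _ h₁, ← hφl _ h₂, heq])
  have hk0 : k ≠ 0 := fun h => hne (by rw [hk, h]; simp)
  have hre : ∀ (m : ℤ) (ζ : ℂ), (ζ + m * (2 * Real.pi * Complex.I)).re = ζ.re := by simp
  have hper : ∀ ζ, l < ζ.re → φ (ζ - (k.natAbs : ℕ) * (2 * Real.pi * Complex.I)) = φ ζ := by
    intro ζ hζ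
    rcases Int.natAbs_eq k with h | h
    · have := inverse_branch_periodic hf.1 hρ hφ hφl (k := -k) h₂ (by
        rw [← heq, hk]; congr 1; push_cast; ring) ζ hζ
      rw [← this]; congr 1
      have h' : (k : ℂ) = (k.natAbs : ℕ) := by
        simpa using congrArg (Int.cast : ℤ → ℂ) h
      push_cast; rw [h']; ring
    · have := inverse_branch_periodic hf.1 hρ hφ hφl (k := k) h₁ (by
        rw [heq, hk]) ζ hζ
      rw [← this]; congr 1
      have h' : (k : ℂ) = -(k.natAbs : ℕ) := by
        simpa using congrArg (Int.cast : ℤ → ℂ) h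
      rw [h']; ring
  exact hf.2 (exists_polynomial_of_periodic_inverse_branch hf.1 hf0 hφ hφl
    (Int.natAbs_pos.2 hk0) hper)

/-! ### Expansion of `f` -/

/-- A holomorphic function on a disc whose image contains no two points that differ by `2πi` has
small derivative at the centre. -/
theorem norm_deriv_mul_le_of_no_translates {Φ : ℂ → ℂ} {ζ₀ : ℂ} {δ : ℝ}
    (hΦ : DifferentiableOn ℂ Φ (Metric.ball ζ₀ δ))
    (hno : ∀ ζ ∈ Metric.ball ζ₀ δ, ∀ ζ' ∈ Metric.ball ζ₀ δ,
      Φ ζ' ≠ Φ ζ + 2 * Real.pi * Complex.I) :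
    ‖deriv Φ ζ₀‖ * δ ≤ 192 * Real.pi := by
  suffices h : ∀ δ' ∈ Ioo 0 δ, ‖deriv Φ ζ₀‖ * δ' ≤ 192 * Real.pi by
    rcases le_or_gt δ 0 with hδ | hδ
    · exact (mul_nonpos_of_nonneg_of_nonpos (norm_nonneg _) hδ).trans (by positivity)
    · have hlim : Tendsto (fun t => ‖deriv Φ ζ₀‖ * t) (𝓝[<] δ) (𝓝 (‖deriv Φ ζ₀‖ * δ)) :=
        ((continuous_const.mul continuous_id).tendsto δ).mono_left nhdsWithin_le_nhds
      refine le_of_tendsto hlim ?_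
      filter_upwards [Ioo_mem_nhdsLT hδ] with t ht using h t ht
  intro δ' ⟨hδ0, hδ'⟩
  have hΦ' : DifferentiableOn ℂ (deriv Φ) (Metric.ball ζ₀ δ) := hΦ.deriv Metric.isOpen_ball
  have hsub : Metric.closedBall ζ₀ δ' ⊆ Metric.ball ζ₀ δ := Metric.closedBall_subset_ball hδ'
  -- Landau's device for Bloch's theorem: where |Φ'| times the distance to the boundary is maximal,
  -- |Φ'| is at most doubled on the disc of half that distance.
  obtain ⟨ζs, hζs, hmax⟩ := (isCompact_closedBall ζ₀ δ').exists_isMaxOn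
    ⟨ζ₀, Metric.mem_closedBall_self hδ0.le⟩
    (f := fun ζ => ‖deriv Φ ζ‖ * (δ' - dist ζ ζ₀))
    ((hΦ'.continuousOn.mono hsub).norm.mul (by fun_prop))
  set M : ℝ := ‖deriv Φ ζs‖ * (δ' - dist ζs ζ₀) with hM
  have hle : ‖deriv Φ ζ₀‖ * δ' ≤ M := by
    have := hmax (Metric.mem_closedBall_self hδ0.le)
    simpa using this
  refine hle.trans ?_
  by_contra hbig
  push Not at hbig
  have hπ := Real.pi_pos
  have hMpos : 0 < M := lt_trans (by positivity) hbig
  have hdist : dist ζs ζ₀ ≤ δ' := hζs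
  set s : ℝ := (δ' - dist ζs ζ₀) / 2 with hs
  set A : ℝ := ‖deriv Φ ζs‖ with hA
  have hMA : M = 2 * (A * s) := by rw [hM, hs]; ring
  have hs0 : 0 < s := by
    rcases (show 0 ≤ s by linarith).eq_or_lt with h | h
    · rw [← h] at hMA; linarith
    · exact h
  have hA0 : 0 < A := by
    refine lt_of_le_of_ne (norm_nonneg _) fun h => ?_
    rw [show A = 0 from h.symm] at hMA; linarith
  have hsubs : Metric.ball ζs s ⊆ Metric.ball ζ₀ δ := fun ζ hζ => hsub (by
    rw [Metric.mem_ball] at hζ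
    rw [Metric.mem_closedBall]
    linarith [dist_triangle ζ ζs ζ₀])
  have hder : ∀ ζ ∈ Metric.ball ζs s, ‖deriv Φ ζ‖ ≤ 2 * A := by
    intro ζ hζ
    rw [Metric.mem_ball] at hζ
    have h1 : s ≤ δ' - dist ζ ζ₀ := by linarith [dist_triangle ζ ζs ζ₀]
    have h2 : ‖deriv Φ ζ‖ * (δ' - dist ζ ζ₀) ≤ M := hmax (by
      rw [Metric.mem_closedBall]; linarith)
    have h3 : ‖deriv Φ ζ‖ * s ≤ 2 * A * s := by
      have := mul_le_mul_of_nonneg_left h1 (norm_nonneg (deriv Φ ζ))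
      linarith
    exact le_of_mul_le_mul_right h3 hs0
  have hschwarz : ∀ ζ ∈ Metric.ball ζs s, ‖deriv Φ ζ - deriv Φ ζs‖ ≤ 3 * A / s * dist ζ ζs := by
    intro ζ hζ
    rw [← dist_eq_norm]
    refine Complex.dist_le_div_mul_dist_of_mapsTo_ball (hΦ'.mono hsubs) (fun ξ hξ => ?_) hζ
    rw [Metric.mem_closedBall, dist_eq_norm]
    linarith [norm_sub_le (deriv Φ ξ) (deriv Φ ζs), hder ξ hξ]
  -- On this radius the Schwarz bound 3A/s · r equals A/2, so Φ differs from its linear part by at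
  -- most half of it.
  set r : ℝ := s / 6 with hr
  have hr0 : 0 < r := by positivity
  have hrs : Metric.closedBall ζs r ⊆ Metric.ball ζs s :=
    Metric.closedBall_subset_ball (by linarith)
  have hdiff : ∀ ζ ∈ Metric.closedBall ζs r, DifferentiableAt ℂ Φ ζ := fun ζ hζ =>
    hΦ.differentiableAt (Metric.isOpen_ball.mem_nhds (hsubs (hrs hζ)))
  have hmv : ∀ ζ ∈ Metric.closedBall ζs r,
      ‖(Φ ζ - deriv Φ ζs * ζ) - (Φ ζs - deriv Φ ζs * ζs)‖ ≤ A / 2 * ‖ζ - ζs‖ := by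
    intro ζ hζ
    refine (convex_closedBall ζs r).norm_image_sub_le_of_norm_hasDerivWithin_le
      (f := fun ζ => Φ ζ - deriv Φ ζs * ζ) (f' := fun ζ => deriv Φ ζ - deriv Φ ζs)
      (fun ξ hξ => ?_) (fun ξ hξ => ?_) (Metric.mem_closedBall_self hr0.le) hζ
    · have := (hdiff ξ hξ).hasDerivAt.sub ((hasDerivAt_id ξ).const_mul (deriv Φ ζs))
      exact (this.congr_deriv (by simp)).hasDerivWithinAt
    · refine (hschwarz ξ (hrs hξ)).trans ?_
      have h1 : dist ξ ζs ≤ r := hξ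
      calc 3 * A / s * dist ξ ζs ≤ 3 * A / s * r := by gcongr
        _ = A / 2 := by rw [hr]; field_simp; norm_num
  have hlow : ∀ ζ ∈ Metric.closedBall ζs r, A / 2 * ‖ζ - ζs‖ ≤ ‖Φ ζ - Φ ζs‖ := by
    intro ζ hζ
    have h1 := hmv ζ hζ
    have h2 : ‖deriv Φ ζs * (ζ - ζs)‖ = A * ‖ζ - ζs‖ := norm_mul _ _
    have h3 : deriv Φ ζs * (ζ - ζs) =
      (Φ ζ - Φ ζs) - ((Φ ζ - deriv Φ ζs * ζ) - (Φ ζs - deriv Φ ζs * ζs)) := by ring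
    have h4 := norm_sub_le (Φ ζ - Φ ζs) ((Φ ζ - deriv Φ ζs * ζ) - (Φ ζs - deriv Φ ζs * ζs))
    rw [← h3, h2] at h4
    linarith
  have hdc : DiffContOnCl ℂ Φ (Metric.ball ζs r) :=
    DifferentiableOn.diffContOnCl_ball (U := Metric.closedBall ζs r)
      (fun ζ hζ => (hdiff ζ hζ).differentiableWithinAt) subset_rfl
  have hfreq : ∃ᶠ z in 𝓝 ζs, Φ z ≠ Φ ζs := by
    have h1 : ∀ᶠ z in 𝓝[≠] ζs, Φ z ≠ Φ ζs := by
      filter_upwards [nhdsWithin_le_nhds (Metric.closedBall_mem_nhds ζs hr0),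
        self_mem_nhdsWithin] with z hz hz' heq
      have h2 := hlow z hz
      rw [heq, sub_self, norm_zero] at h2
      have h3 : 0 < ‖z - ζs‖ := norm_pos_iff.2 (sub_ne_zero.2 hz')
      have : 0 < A / 2 * ‖z - ζs‖ := by positivity
      linarith
    exact h1.frequently.filter_mono nhdsWithin_le_nhds
  have himg := hdc.ball_subset_image_closedBall hr0 (ε := A / 2 * r) (fun z hz => by
    have h1 := hlow z (Metric.sphere_subset_closedBall hz)
    rwa [show ‖z - ζs‖ = r by rw [← dist_eq_norm]; exact hz] at h1) hfreq
  -- The covered disc has radius Ar/4 = As/24 = M/48, and M > 192π makes this exceed 2π.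
  have hmem : Φ ζs + 2 * Real.pi * Complex.I ∈ Metric.ball (Φ ζs) (A / 2 * r / 2) := by
    rw [Metric.mem_ball, dist_eq_norm, add_sub_cancel_left]
    have : ‖(2 * Real.pi * Complex.I : ℂ)‖ = 2 * Real.pi := by
      simp [abs_of_pos hπ]
    rw [this, hr]
    nlinarith
  obtain ⟨ζ', hζ', heq⟩ := himg hmem
  exact hno ζs (hsubs (hrs (Metric.mem_closedBall_self hr0.le))) ζ' (hsubs (hrs hζ')) heq

/-- A nonvanishing holomorphic function on a disc has a holomorphic logarithm. -/
theorem exists_log_on_ball {g : ℂ → ℂ} {c : ℂ} {r : ℝ} (hr : 0 < r)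
    (hg : DifferentiableOn ℂ g (Metric.ball c r)) (hg0 : ∀ z ∈ Metric.ball c r, g z ≠ 0) :
    ∃ u : ℂ → ℂ, (∀ z ∈ Metric.ball c r, HasDerivAt u (deriv g z / g z) z) ∧
      ∀ z ∈ Metric.ball c r, Complex.exp (u z) = g z := by
  have h1 : DifferentiableOn ℂ (fun z => deriv g z / g z) (Metric.ball c r) :=
    (hg.deriv Metric.isOpen_ball).div hg hg0
  have hc := Metric.mem_ball_self (x := c) hr
  obtain ⟨u, hu0, hu⟩ := h1.isExactOn_ball.with_val_at c (Complex.log (g c))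
  refine ⟨u, hu, fun z hz => ?_⟩
  have hd : ∀ z ∈ Metric.ball c r, HasDerivAt (fun z => g z * Complex.exp (-u z)) 0 z := by
    intro z hz
    have h2 := (hg.differentiableAt (Metric.isOpen_ball.mem_nhds hz)).hasDerivAt.mul
      (hu z hz).neg.cexp
    refine h2.congr_deriv ?_
    have := hg0 z hz
    field_simp
    ring
  have h3 : g z * Complex.exp (-u z) = g c * Complex.exp (-u c) :=
    (convex_ball c r).is_const_of_fderivWithin_eq_zero (𝕜 := ℂ)
      (f := fun z => g z * Complex.exp (-u z))
      (fun z hz => (hd z hz).differentiableAt.differentiableWithinAt)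
      (fun z hz => by
        rw [fderivWithin_of_isOpen Metric.isOpen_ball hz]
        simpa using (hd z hz).hasFDerivAt.fderiv) hz hc
  rw [hu0, Complex.exp_neg, Complex.exp_neg, Complex.exp_log (hg0 c hc),
    mul_inv_cancel₀ (hg0 c hc)] at h3
  field_simp at h3
  exact h3.symm

/-- The expansion estimate of Eremenko and Lyubich. -/
theorem log_norm_sub_le_of_lt_norm {f : ℂ → ℂ} (hf : IsTranscendentalEntire f) {l : ℝ}
    (hρ : ∀ s ∈ singularSet f, ‖s‖ ≤ Real.exp l) (hf0 : ‖f 0‖ ≤ Real.exp l) {w : ℂ}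
    (hw : Real.exp l < ‖f w‖) :
    Real.log ‖f w‖ - l ≤ 192 * Real.pi * (‖deriv f w‖ * ‖w‖ / ‖f w‖) := by
  have hfw : f w ≠ 0 := norm_pos_iff.1 ((Real.exp_pos l).trans hw)
  set ζ₀ := Complex.log (f w)
  have hre : ζ₀.re = Real.log ‖f w‖ := Complex.log_re _
  have hζ₀ : l < ζ₀.re := by
    rw [hre, Real.lt_log_iff_exp_lt (norm_pos_iff.2 hfw)]; exact hw
  obtain ⟨φ, hφ, hφ0, hφl⟩ := exists_inverse_branch hf.1 hρ hζ₀
    (show f w = Complex.exp ζ₀ from (Complex.exp_log hfw).symm)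
  have hinj := injOn_inverse_branch hf hρ hf0 hφ hφl
  set δ := ζ₀.re - l with hδ
  have hδ0 : 0 < δ := by linarith
  have hsub : Metric.ball ζ₀ δ ⊆ {ζ | l < ζ.re} := fun ζ hζ => by
    have h1 : |(ζ - ζ₀).re| < δ := (Complex.abs_re_le_norm _).trans_lt (by
      rwa [← dist_eq_norm])
    rw [Complex.sub_re, abs_lt] at h1
    rw [mem_ofPred_eq]; linarith
  have hne : ∀ ζ, l < ζ.re → φ ζ ≠ 0 := fun ζ hζ h0 => by
    have h1 := hφl ζ hζ
    rw [h0] at h1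
    rw [h1, Complex.norm_exp, Real.exp_le_exp] at hf0
    linarith
  obtain ⟨u, hu, hexp⟩ := exists_log_on_ball hδ0 (hφ.mono hsub) fun ζ hζ => hne ζ (hsub hζ)
  -- Here u = log φ. Values of u differing by 2πi would give equal values of φ, against injectivity.
  have hmain := norm_deriv_mul_le_of_no_translates (Φ := u) (ζ₀ := ζ₀) (δ := δ)
    (fun ζ hζ => (hu ζ hζ).differentiableAt.differentiableWithinAt) (fun ζ hζ ζ' hζ' heq => by
      have h1 : φ ζ' = φ ζ := by
        rw [← hexp ζ hζ, ← hexp ζ' hζ', heq, Complex.exp_periodic]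
      rw [hinj (hsub hζ') (hsub hζ) h1] at heq
      simp [Real.pi_ne_zero] at heq)
  have hc := Metric.mem_ball_self (x := ζ₀) hδ0
  rw [(hu ζ₀ hc).deriv, hφ0] at hmain
  have hopen : IsOpen {ζ : ℂ | l < ζ.re} := isOpen_lt continuous_const Complex.continuous_re
  have hφd : HasDerivAt φ (deriv φ ζ₀) ζ₀ :=
    (hφ.differentiableAt (hopen.mem_nhds hζ₀)).hasDerivAt
  have hchain : deriv f w * deriv φ ζ₀ = f w := by
    have h1 : HasDerivAt (fun ζ => f (φ ζ)) (deriv f (φ ζ₀) * deriv φ ζ₀) ζ₀ :=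
      (hf.1 (φ ζ₀)).hasDerivAt.comp ζ₀ hφd
    have h2 : HasDerivAt (fun ζ => f (φ ζ)) (Complex.exp ζ₀) ζ₀ := by
      refine (Complex.hasDerivAt_exp ζ₀).congr_of_eventuallyEq ?_
      filter_upwards [hopen.mem_nhds hζ₀] with ζ hζ using hφl ζ hζ
    have h3 := h1.unique h2
    rw [hφ0] at h3
    rw [h3, Complex.exp_log hfw]
  have hdw : deriv f w ≠ 0 := deriv_ne_zero_of_lt_norm hρ hw
  have hw0 : w ≠ 0 := by rw [← hφ0]; exact hne ζ₀ hζ₀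
  have hquot : ‖deriv φ ζ₀ / w‖ = (‖deriv f w‖ * ‖w‖ / ‖f w‖)⁻¹ := by
    rw [← norm_mul, ← norm_div, ← norm_inv]
    congr 1
    rw [← hchain]
    have : deriv φ ζ₀ ≠ 0 := fun h => hfw (by rw [← hchain, h, mul_zero])
    field_simp
  have hpos : 0 < ‖deriv f w‖ * ‖w‖ / ‖f w‖ := by
    have := norm_pos_iff.2 hdw
    have := norm_pos_iff.2 hw0
    have := norm_pos_iff.2 hfw
    positivity
  rw [hquot, inv_mul_le_iff₀ hpos] at hmain
  rw [← hre]
  linarith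

/-! ### The escaping set is contained in the Julia set -/

theorem IsTranscendentalEntire.isOpenMap {f : ℂ → ℂ} (hf : IsTranscendentalEntire f) :
    IsOpenMap f := by
  rcases (hf.1.differentiableOn.analyticOnNhd isOpen_univ).is_constant_or_isOpen
    isPreconnected_univ with ⟨w, hw⟩ | h
  · exact absurd ⟨Polynomial.C w, fun z => by simpa using hw z (mem_univ z)⟩ hf.2
  · exact fun s hs => h s (subset_univ s) hs

/-- Precomposing with f turns fⁿ on f(U) into fⁿ⁺¹ on U. The limit there is constant on fibres of f,
so it descends, and openness of f preserves local uniformity. -/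
theorem IsNormalFamilyOn.iterates_image {f : ℂ → ℂ} (hopen : IsOpenMap f)
    {U : Set ℂ} (hU : IsOpen U) (h : IsNormalFamilyOn (range fun n : ℕ => f^[n]) U) :
    IsNormalFamilyOn (range fun n : ℕ => f^[n]) (f '' U) := by
  intro F hF
  choose n hn using hF
  obtain ⟨φ, hφ, hlim⟩ := h (fun k => f^[n k + 1]) fun k => ⟨n k + 1, rfl⟩
  have hFw : ∀ k w, F (φ k) (f w) = f^[n (φ k) + 1] w := fun k w => by
    rw [← hn, Function.iterate_succ_apply]
  refine ⟨φ, hφ, hlim.imp ?_ ?_⟩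
  · rintro ⟨g, hg⟩
    have hpt : ∀ w ∈ U, Tendsto (fun k => F (φ k) (f w)) atTop (𝓝 (g w)) := fun w hw => by
      simpa only [hFw] using hg.tendsto_at hw
    have hex : ∀ v, ∃ a, ∀ w ∈ U, f w = v → g w = a := by
      intro v
      by_cases hv : v ∈ f '' U
      · obtain ⟨w₀, hw₀, rfl⟩ := hv
        exact ⟨g w₀, fun w hw heq => tendsto_nhds_unique (heq ▸ hpt w hw) (hpt w₀ hw₀)⟩
      · exact ⟨0, fun w hw heq => absurd ⟨w, hw, heq⟩ hv⟩
    choose g' hg' using hex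
    refine ⟨g', fun u hu x hx => ?_⟩
    obtain ⟨w, hw, rfl⟩ := hx
    obtain ⟨t, ht, htu⟩ := hg u hu w hw
    rw [hU.nhdsWithin_eq hw] at ht
    refine ⟨f '' (t ∩ U), nhdsWithin_le_nhds (hopen.image_mem_nhds
      (inter_mem ht (hU.mem_nhds hw))), htu.mono fun k hk => ?_⟩
    rintro _ ⟨y, ⟨hyt, hyU⟩, rfl⟩
    dsimp only
    rw [hFw, ← hg' (f y) y hyU rfl]
    exact hk y hyt
  · intro hg K hKU hK M
    refine hK.induction_on (p := fun s => ∀ᶠ k in atTop, ∀ w ∈ s, M ≤ ‖F (φ k) w‖)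
      (by simp) (fun s t hst ht => ht.mono fun k hk w hw => hk w (hst hw))
      (fun s t hs ht => (hs.and ht).mono fun k hk w hw => hw.elim (hk.1 w) (hk.2 w)) fun x hx => ?_
    obtain ⟨w, hw, rfl⟩ := hKU hx
    obtain ⟨L, hL, hLU, hLc⟩ := local_compact_nhds (hU.mem_nhds hw)
    refine ⟨f '' L, nhdsWithin_le_nhds (hopen.image_mem_nhds hL), (hg L hLU hLc M).mono ?_⟩
    rintro k hk _ ⟨y, hy, rfl⟩
    rw [hFw]
    exact hk y hy

theorem map_mem_fatouSet {f : ℂ → ℂ} (hf : Continuous f) (hopen : IsOpenMap f) {z : ℂ}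
    (hz : z ∈ fatouSet f) : f z ∈ fatouSet f := by
  obtain ⟨U, hU, hUc, hzU, hn⟩ := hz
  exact ⟨f '' U, hopen U hU, hUc.image f hf.continuousOn, ⟨z, hzU, rfl⟩,
    hn.iterates_image hopen hU⟩

theorem iterate_mem_fatouSet {f : ℂ → ℂ} (hf : Continuous f) (hopen : IsOpenMap f) {z : ℂ}
    (hz : z ∈ fatouSet f) (n : ℕ) : f^[n] z ∈ fatouSet f := by
  induction n with
  | zero => exact hz
  | succ n ih => rw [Function.iterate_succ_apply']; exact map_mem_fatouSet hf hopen ih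

theorem escapingSet_norm {f : ℂ → ℂ} {z : ℂ} (hz : z ∈ escapingSet f) :
    Tendsto (fun n : ℕ => ‖f^[n] z‖) atTop atTop := by
  have : Tendsto (fun n : ℕ => f^[n] z) atTop (cocompact ℂ) := hz
  rwa [← Metric.cobounded_eq_cocompact, ← tendsto_norm_atTop_iff_cobounded] at this

theorem iterate_mem_escapingSet {f : ℂ → ℂ} {z : ℂ} (hz : z ∈ escapingSet f) (N : ℕ) :
    f^[N] z ∈ escapingSet f := by
  have : Tendsto (fun n : ℕ => f^[n] z) atTop (cocompact ℂ) := hz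
  have h := (tendsto_add_atTop_iff_nat N).2 this
  simpa only [escapingSet, mem_ofPred_eq, Function.iterate_add_apply] using h

/-- Near an escaping point of the Fatou set the iterates tend to infinity uniformly. -/
theorem exists_ball_uniform_escape {f : ℂ → ℂ} {z : ℂ} (hz : z ∈ escapingSet f)
    (hzF : z ∈ fatouSet f) :
    ∃ r > 0, ∀ M : ℝ, ∀ᶠ n : ℕ in atTop, ∀ w ∈ Metric.ball z r, M ≤ ‖f^[n] w‖ := by
  obtain ⟨U, hU, -, hzU, hn⟩ := hzF
  obtain ⟨r, hr, hrU⟩ := Metric.nhds_basis_closedBall.mem_iff.1 (hU.mem_nhds hzU)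
  refine ⟨r, hr, fun M => ?_⟩
  by_contra hcon
  obtain ⟨ψ, hψ, hψM⟩ := extraction_of_frequently_atTop (not_eventually.1 hcon)
  obtain ⟨φ, hφ, hlim⟩ := hn (fun k => f^[ψ k]) fun k => ⟨ψ k, rfl⟩
  rcases hlim with ⟨g, hg⟩ | hg
  · have h1 := (hg.tendsto_at hzU).norm
    have h2 := (escapingSet_norm hz).comp (hψ.comp hφ).tendsto_atTop
    exact not_tendsto_nhds_of_tendsto_atTop h2 _ h1
  · obtain ⟨k, hk⟩ := (hg _ hrU (isCompact_closedBall z r) M).exists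
    exact hψM (φ k) fun w hw => hk w (Metric.ball_subset_closedBall hw)

/-- A holomorphic function of modulus greater than `1` on a disc has controlled logarithmic
derivative at the centre. -/
theorem norm_deriv_div_le_of_one_lt_norm {g : ℂ → ℂ} {c : ℂ} {r : ℝ} (hr : 0 < r)
    (hg : DifferentiableOn ℂ g (Metric.ball c r)) (hg1 : ∀ z ∈ Metric.ball c r, 1 < ‖g z‖) :
    ‖deriv g c‖ / ‖g c‖ ≤ 4 * Real.log ‖g c‖ / r := by
  obtain ⟨u, hu, hexp⟩ := exists_log_on_ball hr hg fun z hz h0 => by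
    have := hg1 z hz
    rw [h0, norm_zero] at this
    linarith
  have hc := Metric.mem_ball_self (x := c) hr
  have hre : ∀ z ∈ Metric.ball c r, (u z).re = Real.log ‖g z‖ := fun z hz => by
    rw [← hexp z hz, Complex.norm_exp, Real.log_exp]
  have hpos : ∀ z ∈ Metric.ball c r, 0 < (u z).re := fun z hz => by
    rw [hre z hz]; exact Real.log_pos (hg1 z hz)
  have hball : ∀ z : ℂ, z ∈ Metric.ball 0 r → c + z ∈ Metric.ball c r := fun z hz => by
    simpa [Metric.mem_ball, dist_eq_norm] using hz
  have hd : ∀ z ∈ Metric.ball (0 : ℂ) r, HasDerivAt (fun z => u c - u (c + z))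
      (-(deriv g (c + z) / g (c + z))) z := fun z hz => by
    have h1 := (hu (c + z) (hball z hz)).comp_const_add c z
    exact h1.const_sub (u c)
  have hdo : DifferentiableOn ℂ (fun z => u c - u (c + z)) (Metric.ball 0 r) := fun z hz =>
    (hd z hz).differentiableAt.differentiableWithinAt
  -- Borel–Carathéodory applies because Re(u(c) - u(c+z)) < Re u(c). Cauchy's estimate on the same
  -- circle then yields the constant 4.
  have hbound : ∀ z ∈ Metric.sphere (0 : ℂ) (r / 2), ‖u c - u (c + z)‖ ≤ 2 * (u c).re := by
    intro z hz
    have hzn : ‖z‖ = r / 2 := by simpa using hz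
    have := Complex.borelCaratheodory_zero (hpos c hc) hdo (fun z hz => by
      have := hpos _ (hball z hz)
      simp only [mem_ofPred_eq, Complex.sub_re]
      linarith) hr (z := z) (by simp [hzn]; linarith) (by simp)
    refine this.trans (le_of_eq ?_)
    rw [hzn]
    field_simp
    ring
  have hcauchy := Complex.norm_deriv_le_of_forall_mem_sphere_norm_le (half_pos hr)
    (DifferentiableOn.diffContOnCl_ball hdo (Metric.closedBall_subset_ball (by linarith))) hbound
  rw [(hd 0 (Metric.mem_ball_self hr)).deriv, add_zero, norm_neg, norm_div, hre c hc] at hcauchy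
  refine hcauchy.trans (le_of_eq ?_)
  ring

theorem exists_exp_bound_of_mem_class {f : ℂ → ℂ} (hf : f ∈ EremenkoLyubichClass) :
    ∃ l : ℝ, 0 ≤ l ∧ (∀ s ∈ singularSet f, ‖s‖ ≤ Real.exp l) ∧ ‖f 0‖ ≤ Real.exp l := by
  obtain ⟨C, hC⟩ := hf.2.exists_norm_le
  have h1 : ∀ x : ℝ, x ≤ Real.exp x := fun x => by linarith [Real.add_one_le_exp x]
  refine ⟨max (max C ‖f 0‖) 0, le_max_right _ _, fun s hs => ?_, ?_⟩
  · exact (hC s hs).trans (((le_max_left _ _).trans (le_max_left _ _)).trans (h1 _))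
  · exact ((le_max_right _ _).trans (le_max_left _ _)).trans (h1 _)

/-- Put aₙ = log|fⁿ(z)| and bₙ = |(fⁿ)'(z)|/|fⁿ(z)|. In the Fatou set escape is uniform on a disc,
so bₙ ≤ 4aₙ/r eventually. Expansion gives bₙ(aₙ₊₁ - l) ≤ C₀bₙ₊₁. Since aₙ → ∞, bₙ is both eventually
bounded and at least doubling, which is absurd. -/
theorem escapingSet_subset_juliaSet {f : ℂ → ℂ} (hf : f ∈ EremenkoLyubichClass) :
    escapingSet f ⊆ juliaSet f := by
  intro z₀ hz₀ hz₀F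
  obtain ⟨l, hl0, hρ, hf0⟩ := exists_exp_bound_of_mem_class hf
  obtain ⟨N, hN⟩ := eventually_atTop.1 ((escapingSet_norm hz₀).eventually_gt_atTop (Real.exp l))
  have hcont := hf.1.1.continuous
  set z := f^[N] z₀ with hzdef
  have hz : z ∈ escapingSet f := iterate_mem_escapingSet hz₀ N
  have hzF : z ∈ fatouSet f := iterate_mem_fatouSet hcont hf.1.isOpenMap hz₀F N
  have hlarge : ∀ n : ℕ, Real.exp l < ‖f^[n] z‖ := fun n => by
    rw [hzdef, ← Function.iterate_add_apply]; exact hN _ (by omega)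
  have hpos : ∀ n : ℕ, 0 < ‖f^[n] z‖ := fun n => (Real.exp_pos l).trans (hlarge n)
  have hderiv : ∀ n : ℕ, deriv f^[n + 1] z = deriv f (f^[n] z) * deriv f^[n] z := fun n => by
    rw [Function.iterate_succ']
    exact deriv_comp z (hf.1.1 _) ((hf.1.1.iterate n) z)
  have hne : ∀ n : ℕ, deriv f (f^[n] z) ≠ 0 := fun n => deriv_ne_zero_of_lt_norm hρ (by
    rw [← Function.iterate_succ_apply' f]; exact hlarge _)
  set a : ℕ → ℝ := fun n => Real.log ‖f^[n] z‖
  set b : ℕ → ℝ := fun n => ‖deriv f^[n] z‖ / ‖f^[n] z‖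
  have hb0 : ∀ n, 0 < b n := by
    intro n
    refine div_pos (norm_pos_iff.2 ?_) (hpos n)
    induction n with
    | zero => simp
    | succ n ih => rw [hderiv]; exact mul_ne_zero (hne n) ih
  have hC0 : (0 : ℝ) < 192 * Real.pi := by positivity
  set C₀ := 192 * Real.pi
  have hexpand : ∀ n, b n * (a (n + 1) - l) ≤ C₀ * b (n + 1) := by
    intro n
    have h1 := log_norm_sub_le_of_lt_norm hf.1 hρ hf0 (w := f^[n] z) (by
      rw [← Function.iterate_succ_apply' f]; exact hlarge _)
    rw [← Function.iterate_succ_apply' f] at h1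
    have h2 := mul_le_mul_of_nonneg_left h1 (hb0 n).le
    refine h2.trans (le_of_eq ?_)
    simp only [b]
    rw [hderiv, norm_mul]
    have := (hpos n).ne'
    have := (hpos (n + 1)).ne'
    simp only [Nat.succ_eq_add_one, C₀]
    field_simp
  have ha : Tendsto a atTop atTop := Real.tendsto_log_atTop.comp (escapingSet_norm hz)
  obtain ⟨r, hr, hunif⟩ := exists_ball_uniform_escape hz hzF
  have hupper : ∀ᶠ n in atTop, b n ≤ 4 * a n / r := by
    filter_upwards [hunif 2] with n hn
    exact norm_deriv_div_le_of_one_lt_norm hr (hf.1.1.iterate n).differentiableOn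
      fun w hw => by linarith [hn w hw]
  have ha' : Tendsto (fun n => a (n + 1)) atTop atTop := ha.comp (tendsto_add_atTop_nat 1)
  have hupper' : ∀ᶠ n in atTop, b (n + 1) ≤ 4 * a (n + 1) / r :=
    (tendsto_add_atTop_nat 1).eventually hupper
  obtain ⟨m, hm⟩ := eventually_atTop.1 ((hupper'.and (ha'.eventually_ge_atTop (2 * l))).and
    (ha'.eventually_ge_atTop (4 * C₀)))
  have hhalf : ∀ n ≥ m, b n * a (n + 1) ≤ 2 * C₀ * b (n + 1) := fun n hn => by
    obtain ⟨⟨-, h2⟩, -⟩ := hm n hn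
    nlinarith [hexpand n, hb0 n]
  -- Inserting the upper bound for bₙ₊₁ into the expansion inequality cancels aₙ₊₁.
  have hbounded : ∀ n ≥ m, b n ≤ 8 * C₀ / r := fun n hn => by
    obtain ⟨⟨h1, -⟩, h3⟩ := hm n hn
    have ha0 : 0 < a (n + 1) := by linarith
    refine le_of_mul_le_mul_right ((hhalf n hn).trans ?_) ha0
    calc 2 * C₀ * b (n + 1) ≤ 2 * C₀ * (4 * a (n + 1) / r) := by gcongr
      _ = 8 * C₀ / r * a (n + 1) := by ring
  have hdouble : ∀ n ≥ m, 2 * b n ≤ b (n + 1) := fun n hn => by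
    obtain ⟨-, h3⟩ := hm n hn
    have h4 := hhalf n hn
    have h5 := mul_le_mul_of_nonneg_left h3 (hb0 n).le
    refine le_of_mul_le_mul_left (a := 2 * C₀) ?_ (by positivity)
    linarith
  have hgrow : ∀ k : ℕ, 2 ^ k * b m ≤ b (m + k) := by
    intro k
    induction k with
    | zero => simp
    | succ k ih =>
      have := hdouble (m + k) (by omega)
      rw [pow_succ, ← add_assoc]
      linarith
  have hinf : Tendsto (fun k : ℕ => (2 : ℝ) ^ k * b m) atTop atTop :=
    (tendsto_pow_atTop_atTop_of_one_lt one_lt_two).atTop_mul_const (hb0 m)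
  obtain ⟨k, hk⟩ := (hinf.eventually_gt_atTop (8 * C₀ / r)).exists
  linarith [hgrow k, hbounded (m + k) (by omega)]

/-! ### Tails of hairs -/

/-- The parametrised tail of the hair through `w`, in the coordinates given by `h`. -/
noncomputable def hairTail (h : ℂ ≃ₜ ℝ × ℝ) (w : ℂ) (s : NNReal) : ℂ :=
  h.symm ((h w).1 + s, (h w).2)

theorem hairTail_zero (h : ℂ ≃ₜ ℝ × ℝ) (w : ℂ) : hairTail h w 0 = w := by simp [hairTail]

theorem continuous_hairTail (h : ℂ ≃ₜ ℝ × ℝ) (w : ℂ) : Continuous (hairTail h w) :=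
  h.symm.continuous.comp (by fun_prop)

theorem hairTail_injective (h : ℂ ≃ₜ ℝ × ℝ) (w : ℂ) : Function.Injective (hairTail h w) := by
  intro s s' hs
  simpa using h.symm.injective hs

theorem tendsto_hairTail (h : ℂ ≃ₜ ℝ × ℝ) (w : ℂ) :
    Tendsto (hairTail h w) atTop (cocompact ℂ) := by
  refine Tendsto.mono_right ?_ (comap_cocompact_le (f := fun v => (h v).1) (by fun_prop))
  rw [tendsto_comap_iff]
  refine Tendsto.mono_right ?_ atTop_le_cocompact
  refine (tendsto_atTop_add_const_left _ (h w).1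
    (NNReal.tendsto_coe_atTop.2 tendsto_id)).congr fun s => ?_
  simp [hairTail]

theorem isArcToInfty_hairTail (h : ℂ ≃ₜ ℝ × ℝ) (w : ℂ) :
    IsArcToInfty (range (hairTail h w)) w :=
  ⟨hairTail h w, continuous_hairTail h w, hairTail_injective h w, hairTail_zero h w,
    tendsto_hairTail h w, rfl⟩

theorem hairTail_mem {B : Set (ℝ × ℝ)} (hB : IsStraightBrush B) {h : ℂ ≃ₜ ℝ × ℝ} {w : ℂ}
    (hw : h w ∈ B) (s : NNReal) : h (hairTail h w s) ∈ B := by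
  obtain ⟨-, -, -, t, ht, -⟩ := hB
  have h1 := (ht (h w).2 ⟨(h w).1, hw⟩).2
  have h2 : (h w).1 ∈ Ici (t (h w).2) := by rw [← h1]; exact hw
  have h3 : (h w).1 + s ∈ Ici (t (h w).2) :=
    le_trans h2 (le_add_of_nonneg_right s.2)
  rw [← h1] at h3
  simpa [hairTail] using h3

/-- The tails of points far out on the brush avoid a given disc. -/
theorem exists_forall_le_norm_hairTail {B : Set (ℝ × ℝ)} (hB : IsStraightBrush B)
    (h : ℂ ≃ₜ ℝ × ℝ) (M : ℝ) :
    ∃ C : ℝ, ∀ w, h w ∈ B → C < ‖h w‖ → ∀ s, M ≤ ‖hairTail h w s‖ := by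
  obtain ⟨C, hC⟩ := ((isCompact_closedBall (0 : ℂ) M).image h.continuous).isBounded.exists_norm_le
  refine ⟨C, fun w hw hCw s => ?_⟩
  by_contra hlt
  have h1 := hC (h (hairTail h w s)) (mem_image_of_mem h (by simpa using (not_le.1 hlt).le))
  have h0 := (hB.1 _ hw).1
  have hs : (0 : ℝ) ≤ s := s.2
  rw [hairTail, Homeomorph.apply_symm_apply, Prod.norm_def, max_le_iff, Real.norm_eq_abs,
    abs_of_nonneg (by positivity)] at h1
  -- Moving out along a tail cannot decrease the norm in brush coordinates, so a tail meeting the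
  -- disc would start within C.
  refine absurd hCw (not_lt.2 ?_)
  rw [Prod.norm_def, max_le_iff, Real.norm_eq_abs, abs_of_nonneg h0]
  exact ⟨by linarith [h1.1], h1.2⟩

/-- A continuous function with irrational values on a connected space is constant. -/
theorem eq_of_forall_irrational {Y : Type*} [TopologicalSpace Y] [PreconnectedSpace Y] {y : Y → ℝ}
    (hy : Continuous y) (hirr : ∀ s, Irrational (y s)) (s s' : Y) : y s = y s' := by
  by_contra hne
  wlog hlt : y s < y s' generalizing s s'
  · exact this s' s (Ne.symm hne) (lt_of_le_of_ne (not_lt.1 hlt) (Ne.symm hne))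
  obtain ⟨q, h1, h2⟩ := exists_rat_btwn hlt
  obtain ⟨u, hu⟩ := mem_range_of_exists_le_of_exists_ge hy ⟨s, h1.le⟩ ⟨s', h2.le⟩
  exact hirr u ⟨q, hu.symm⟩

/-- An arc to infinity inside a brush is the tail of a hair. -/
theorem range_eq_range_hairTail {B : Set (ℝ × ℝ)} (hB : IsStraightBrush B) {h : ℂ ≃ₜ ℝ × ℝ}
    {σ : NNReal → ℂ} (hσ : Continuous σ) (hinj : Function.Injective σ)
    (hinf : Tendsto σ atTop (cocompact ℂ)) (hσB : ∀ s, h (σ s) ∈ B) :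
    range σ = range (hairTail h (σ 0)) := by
  have hy : ∀ s, (h (σ s)).2 = (h (σ 0)).2 := fun s =>
    eq_of_forall_irrational (y := fun s => (h (σ s)).2) (by fun_prop)
      (fun s => (hB.1 _ (hσB s)).2) s 0
  set ξ : NNReal → ℝ := fun s => (h (σ s)).1
  have hξc : Continuous ξ := by fun_prop
  have hξ : ∀ s, h (σ s) = (ξ s, (h (σ 0)).2) := fun s => Prod.ext rfl (hy s)
  have hξinj : Function.Injective ξ := fun s s' hs => hinj (h.injective (by rw [hξ, hξ s', hs]))
  have hξinf : Tendsto ξ atTop atTop := by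
    have h1 : Tendsto (fun s => h.symm (ξ s, (h (σ 0)).2)) atTop (cocompact ℂ) :=
      hinf.congr fun s => by rw [← hξ, Homeomorph.symm_apply_apply]
    have h2 : Tendsto ξ atTop (cocompact ℝ) := by
      refine Tendsto.mono_right (tendsto_comap_iff (g := fun x : ℝ => h.symm (x, (h (σ 0)).2)).2 h1)
        (comap_cocompact_le (by fun_prop))
    refine ((tendsto_norm_cocompact_atTop (E := ℝ)).comp h2).congr fun s => ?_
    simp only [Function.comp]
    rw [Real.norm_eq_abs, abs_of_nonneg (hB.1 _ (hσB s)).1]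
  -- An injective continuous abscissa is strictly monotone, and its divergence to +∞ rules out
  -- decrease.
  have hmono : StrictMono ξ := by
    refine (hξc.strictMono_of_inj hξinj).resolve_right fun hanti => ?_
    obtain ⟨s, hs⟩ := (hξinf.eventually_gt_atTop (ξ 0)).exists
    exact absurd (hanti.antitone zero_le) (not_le.2 hs)
  ext v
  constructor
  · rintro ⟨s, rfl⟩
    refine ⟨⟨ξ s - ξ 0, sub_nonneg.2 (hmono.monotone zero_le)⟩, ?_⟩
    refine h.symm_apply_eq.2 ?_
    rw [hξ s]
    exact Prod.ext (add_sub_cancel (ξ 0) (ξ s)) rfl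
  · rintro ⟨s, rfl⟩
    obtain ⟨s', hs'⟩ := mem_range_of_exists_le_of_exists_ge (c := ξ 0 + s) hξc
      ⟨0, le_add_of_nonneg_right s.2⟩ (hξinf.eventually_ge_atTop _).exists
    refine ⟨s', ?_⟩
    refine (h.symm_apply_eq.2 ?_).symm
    rw [hξ s', hs']

/-- If the tail at `f w` is far out, then `f` maps the tail at `w` bijectively onto it. -/
theorem injOn_and_image_hairTail {f : ℂ → ℂ} (hf : IsTranscendentalEntire f) {l R : ℝ}
    (hρ : ∀ s ∈ singularSet f, ‖s‖ ≤ Real.exp l) {B : Set (ℝ × ℝ)} (hB : IsStraightBrush B)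
    {h : ℂ ≃ₜ ℝ × ℝ} (hJ : h '' juliaSetOutside f R = B) {w : ℂ} (hfw : h (f w) ∈ B)
    (hl : ∀ s, Real.exp l < ‖hairTail h (f w) s‖) (hR : ∀ s, R ≤ ‖hairTail h (f w) s‖) :
    InjOn f (range (hairTail h w)) ∧ f '' range (hairTail h w) = range (hairTail h (f w)) := by
  have hmem : ∀ v, h v ∈ B ↔ v ∈ juliaSetOutside f R := fun v => by
    rw [← hJ]; exact h.injective.mem_set_image
  obtain ⟨σ, hσ, hσ0, hσl⟩ := exists_lift_of_lt_norm hf.1 hρ (Y := NNReal) (y₀ := 0)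
    (fun x => unitInterval.toNNReal x.1 * x.2) (by fun_prop) (by simp) (by simp) (by simp) (continuous_hairTail h (f w)) hl
    (z := w) (hairTail_zero h (f w)).symm
  have hinj : Function.Injective σ := fun s s' hs => hairTail_injective h (f w) (by
    rw [← hσl, ← hσl, hs])
  have hinf : Tendsto σ atTop (cocompact ℂ) :=
    Tendsto.mono_right (tendsto_comap_iff.2
      ((tendsto_hairTail h (f w)).congr fun s => (hσl s).symm)) (comap_cocompact_le hf.1.continuous)
  -- Membership in J_R(f) constrains only the iterates with n ≥ 1: the first is the given tail,
  -- bounded below by `hR`, and the later ones are controlled because that tail lies in J_R(f).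
  have hσB : ∀ s, h (σ s) ∈ B := fun s => by
    obtain ⟨h1, h2⟩ := (hmem _).1 (hairTail_mem hB hfw s)
    rw [hmem]
    refine ⟨fun hF => h1 ?_, fun n hn => ?_⟩
    · rw [← hσl]; exact map_mem_fatouSet hf.1.continuous hf.isOpenMap hF
    · obtain ⟨m, rfl⟩ := Nat.exists_eq_succ_of_ne_zero (by omega : n ≠ 0)
      rw [Function.iterate_succ_apply, hσl]
      rcases Nat.eq_zero_or_pos m with rfl | hm
      · exact hR s
      · exact h2 m hm
  have hrange := range_eq_range_hairTail hB hσ hinj hinf hσB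
  rw [hσ0] at hrange
  rw [← hrange]
  constructor
  · rintro _ ⟨s, rfl⟩ _ ⟨s', rfl⟩ heq
    rw [hσl, hσl] at heq
    rw [hairTail_injective h (f w) heq]
  · rw [← range_comp]
    exact congrArg range (funext hσl)

/-! ### Hair tails along an escaping orbit. -/

theorem mainTheorem8 (f : ℂ → ℂ) (hf : f ∈ EremenkoLyubichClass)
    (R : ℝ) (hR : 0 ≤ R) (hJ : IsCantorBouquet (juliaSetOutside f R)) :
    IsCriniferous f := by
  obtain ⟨B, hB, h, hhB⟩ := hJ
  obtain ⟨l, -, hρ, -⟩ := exists_exp_bound_of_mem_class hf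
  intro z hz
  have hnorm : Tendsto (fun n => ‖h (f^[n] z)‖) atTop atTop := by
    have h1 : Tendsto (fun n : ℕ => f^[n] z) atTop (cocompact ℂ) := hz
    exact (tendsto_norm_cocompact_atTop).comp
      (h.isClosedEmbedding.tendsto_cocompact.comp h1)
  have hmem : ∀ᶠ n in atTop, h (f^[n] z) ∈ B := by
    obtain ⟨N, hN⟩ := eventually_atTop.1 ((escapingSet_norm hz).eventually_ge_atTop R)
    filter_upwards [eventually_ge_atTop N] with n hn
    rw [← hhB]
    refine mem_image_of_mem h ⟨escapingSet_subset_juliaSet hf (iterate_mem_escapingSet hz n),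
      fun m _ => ?_⟩
    rw [← Function.iterate_add_apply]
    exact hN _ (by omega)
  have hfar : ∀ M : ℝ, ∀ᶠ n in atTop, ∀ s, M ≤ ‖hairTail h (f^[n] z) s‖ := fun M => by
    obtain ⟨C, hC⟩ := exists_forall_le_norm_hairTail hB h M
    filter_upwards [hmem, hnorm.eventually_gt_atTop C] with n h1 h2 using hC _ h1 h2
  -- The constant exceeds exp l strictly, as lifting requires, and also exceeds R.
  obtain ⟨N, hN⟩ := eventually_atTop.1 (hmem.and (hfar (Real.exp l + 1 + R)))
  refine ⟨N, fun n => range (hairTail h (f^[n] z)), fun n hn => ⟨isArcToInfty_hairTail h _, ?_⟩,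
    fun M => (hfar M).mono fun n hn w hw => ?_⟩
  · obtain ⟨h1, h2⟩ := hN (n + 1) (by omega)
    dsimp only
    rw [Function.iterate_succ_apply'] at h1 h2 ⊢
    exact injOn_and_image_hairTail hf.1 hρ hB hhB h1 (fun s => by linarith [h2 s])
      (fun s => by linarith [h2 s, Real.exp_pos l])
  · obtain ⟨s, rfl⟩ := hw
    exact hn s
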